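/- Let $(\mathcal X,d)$ be a Polish space, that is, a metric space whose topology is separable and completely metrizable (for instance a complete separable metric space), let $\mathcal P(\mathcal X)$ be the set of all Borel probability measures on $\mathcal X$, and let $\lambda>0$. For $\mu,\nu\in\mathcal P(\mathcal X)$ let $$W^{(\lambda)}(\mu,\nu)=\inf_{\pi\in\Pi(\mu,\nu)}\int_{\mathcal X\times\mathcal X}\min\{d(x,y),2\lambda\}\,d\pi(x,y),$$ where $\Pi(\mu,\nu)$ is the set of all probability measures on $\mathcal X\times\mathcal X$ with first marginal $\mu$ and second marginal $\nu$. Then: (i) $W^{(\lambda)}$ metrizes weak convergence in $\mathcal P(\mathcal X)$: it is a (finite) metric on $\mathcal P(\mathcal X)$, and the topology that it induces is the topology of weak convergence of probability measures. (ii) For every sequence $(\mu_k)_{k\in\mathbb N}$ in $\mathcal P(\mathcal X)$ and every $\mu\in\mathcal P(\mathcal X)$, the sequence $(\mu_k)$ converges weakly to $\mu$ if and only if $W^{(\lambda)}(\mu_k,\mu)\to 0$. (iii) If $\mu_k\to\mu$ weakly and $\nu_k\to\nu$ weakly in $\mathcal P(\mathcal X)$, then $W^{(\lambda)}(\mu_k,\nu_k)\to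 W^{(\lambda)}(\mu,\nu)$. -/

import Mathlib

open MeasureTheory Filter Topology

/-- The set `Π(μ, ν)` of couplings of two probability measures: the probability measures on the
product space whose first marginal is `μ` and whose second marginal is `ν`. -/
def couplings {X Y : Type*} [MeasurableSpace X] [MeasurableSpace Y]
    (μ : ProbabilityMeasure X) (ν : ProbabilityMeasure Y) : Set (ProbabilityMeasure (X × Y)) :=
  {π | (π : Measure (X × Y)).map Prod.fst = (μ : Measure X) ∧
    (π : Measure (X × Y)).map Prod.snd = (ν : Measure Y)}

/-- The trimmed cost `c_lam(x, y) = min {d(x, y), 2 lam}`. -/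
noncomputable def trimmedCost {X : Type*} [MetricSpace X] (lam : ℝ) (x y : X) : ℝ :=
  min (dist x y) (2 * lam)

/-- The robust Wasserstein distance with parameter `lam`: the infimum of the expected trimmed cost
over all couplings. -/
noncomputable def robustWasserstein {X : Type*} [MetricSpace X] [MeasurableSpace X]
    (lam : ℝ) (μ ν : ProbabilityMeasure X) : ℝ :=
  sInf ((fun π : ProbabilityMeasure (X × X) =>
    ∫ p, trimmedCost lam p.1 p.2 ∂(π : Measure (X × X))) '' couplings μ ν)

/-- `dst` is (the distance function of) a metric on `α` that induces the given topology of `α`. -/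
def Metrizes {α : Type*} [t : TopologicalSpace α] (dst : α → α → ℝ) : Prop :=
  ∃ M : MetricSpace α, (∀ a b : α, M.dist a b = dst a b) ∧ M.toUniformSpace.toTopologicalSpace = t

open ProbabilityTheory
open scoped NNReal ENNReal

/-! The trimmed cost is itself a bounded metric, so gluing couplings gives the triangle inequality.
A bounded Lipschitz function is Lipschitz for the trimmed cost, and such functions test weak
convergence; hence small distance forces weak convergence, and distance zero forces equality.

The converse uses neither tightness nor optimal couplings. A continuous partition of unity into
pieces of diameter at most `δ` has finitely many members carrying almost all of `μ`. Weak
convergence makes `μs k` and `μ` nearly agree on each of these, so their common mass can be coupled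
inside the pieces at cost at most `δ`; the little mass left over costs at most `2 * lam` per unit.
-/

/-- **Gluing lemma**: two probability measures that agree on their common marginal are the
two-dimensional marginals of one measure on the triple product. -/
theorem exists_gluing {X Y Z : Type*} [MeasurableSpace X] [MeasurableSpace Y] [MeasurableSpace Z]
    [StandardBorelSpace X] [StandardBorelSpace Z]
    (π₁ : Measure (X × Y)) (π₂ : Measure (Y × Z))
    [IsProbabilityMeasure π₁] [IsProbabilityMeasure π₂]
    (h : π₁.map Prod.snd = π₂.map Prod.fst) :
    ∃ γ : Measure (Y × X × Z), γ.map (fun p => (p.2.1, p.1)) = π₁ ∧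
      γ.map (fun p => (p.1, p.2.2)) = π₂ := by
  have : Nonempty X := (nonempty_of_isProbabilityMeasure π₁).map Prod.fst
  have : Nonempty Z := (nonempty_of_isProbabilityMeasure π₂).map Prod.snd
  let ρ := π₁.map Prod.swap
  have : IsProbabilityMeasure ρ := Measure.isProbabilityMeasure_map (by fun_prop)
  have hρ : ρ.fst = π₂.fst := by rw [Measure.fst_map_swap]; exact h
  -- Given the shared coordinate, the other two are taken conditionally independent.
  let K := ρ.condKernel ×ₖ π₂.condKernel
  have h₁ : (π₂.fst ⊗ₘ K).map (Prod.map id Prod.fst) = ρ := by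
    rw [← Measure.compProd_map measurable_fst, ← Kernel.fst_eq, Kernel.fst_prod, ← hρ,
      ρ.disintegrate]
  have h₂ : (π₂.fst ⊗ₘ K).map (Prod.map id Prod.snd) = π₂ := by
    rw [← Measure.compProd_map measurable_snd, ← Kernel.snd_eq, Kernel.snd_prod,
      π₂.disintegrate]
  refine ⟨π₂.fst ⊗ₘ K, ?_, h₂⟩
  have h₃ : (ρ.map Prod.swap) = π₁ := by
    rw [Measure.map_map (by fun_prop) (by fun_prop), Prod.swap_swap_eq, Measure.map_id]
  rw [← h₃, ← h₁, Measure.map_map (by fun_prop) (by fun_prop)]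
  rfl

/-! ### The trimmed cost as a bounded metric -/

section TrimmedCost

variable {X : Type*} [MetricSpace X] {lam : ℝ}

theorem trimmedCost_nonneg (hlam : 0 < lam) (x y : X) : 0 ≤ trimmedCost lam x y :=
  le_min dist_nonneg (by positivity)

theorem trimmedCost_le (x y : X) : trimmedCost lam x y ≤ 2 * lam := min_le_right _ _

theorem trimmedCost_self (hlam : 0 < lam) (x : X) : trimmedCost lam x x = 0 := by
  simp [trimmedCost, hlam.le]

theorem trimmedCost_comm (x y : X) : trimmedCost lam x y = trimmedCost lam y x := by
  simp [trimmedCost, dist_comm]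

theorem trimmedCost_triangle (hlam : 0 < lam) (x y z : X) :
    trimmedCost lam x z ≤ trimmedCost lam x y + trimmedCost lam y z := by
  have := dist_triangle x y z
  have h₁ := @dist_nonneg _ _ x y
  have h₂ := @dist_nonneg _ _ y z
  unfold trimmedCost
  grind

theorem continuous_trimmedCost : Continuous fun p : X × X => trimmedCost lam p.1 p.2 := by
  unfold trimmedCost
  fun_prop

variable [PolishSpace X] [MeasurableSpace X] [BorelSpace X]

theorem integrable_trimmedCost (hlam : 0 < lam) {Ω : Type*} [MeasurableSpace Ω] {π : Measure Ω}
    [IsFiniteMeasure π] {f g : Ω → X} (hf : Measurable f) (hg : Measurable g) :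
    Integrable (fun ω => trimmedCost lam (f ω) (g ω)) π := by
  refine Integrable.of_bound (C := 2 * lam)
    ((continuous_trimmedCost (lam := lam)).measurable.comp (hf.prodMk hg)).aestronglyMeasurable
    (ae_of_all _ fun ω => ?_)
  rw [Real.norm_of_nonneg (trimmedCost_nonneg hlam _ _)]
  exact trimmedCost_le _ _

end TrimmedCost

theorem couplings_nonempty {X Y : Type*} [MeasurableSpace X] [MeasurableSpace Y]
    (μ : ProbabilityMeasure X) (ν : ProbabilityMeasure Y) : (couplings μ ν).Nonempty :=
  ⟨μ.prod ν, by simp [couplings]⟩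

/-! ### Metric axioms and control of weak convergence -/

section RobustWasserstein

variable {X : Type*} [MetricSpace X] [MeasurableSpace X] {lam : ℝ}

theorem robustWasserstein_nonneg (hlam : 0 < lam) (μ ν : ProbabilityMeasure X) :
    0 ≤ robustWasserstein lam μ ν := by
  apply Real.sInf_nonneg
  rintro _ ⟨π, -, rfl⟩
  exact integral_nonneg fun p => trimmedCost_nonneg hlam _ _

theorem robustWasserstein_le (hlam : 0 < lam) {μ ν : ProbabilityMeasure X}
    {π : ProbabilityMeasure (X × X)} (hπ : π ∈ couplings μ ν) :
    robustWasserstein lam μ ν ≤ ∫ p, trimmedCost lam p.1 p.2 ∂(π : Measure (X × X)) := by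
  refine csInf_le ⟨0, ?_⟩ ⟨π, hπ, rfl⟩
  rintro _ ⟨π, -, rfl⟩
  exact integral_nonneg fun p => trimmedCost_nonneg hlam _ _

theorem le_robustWasserstein {μ ν : ProbabilityMeasure X} {C : ℝ}
    (h : ∀ π ∈ couplings μ ν, C ≤ ∫ p, trimmedCost lam p.1 p.2 ∂(π : Measure (X × X))) :
    C ≤ robustWasserstein lam μ ν := by
  refine le_csInf ((couplings_nonempty μ ν).image _) ?_
  rintro _ ⟨π, hπ, rfl⟩
  exact h π hπ

variable [PolishSpace X] [BorelSpace X]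

theorem robustWasserstein_self (hlam : 0 < lam) (μ : ProbabilityMeasure X) :
    robustWasserstein lam μ μ = 0 := by
  refine le_antisymm ?_ (robustWasserstein_nonneg hlam μ μ)
  have hd : Measurable fun x : X => (x, x) := by fun_prop
  have hπ : μ.map hd.aemeasurable ∈ couplings μ μ := by
    simp only [couplings, Set.mem_ofPred_eq, ProbabilityMeasure.toMeasure_map]
    rw [Measure.map_map (by fun_prop) hd, Measure.map_map (by fun_prop) hd]
    exact ⟨Measure.map_id, Measure.map_id⟩
  refine (robustWasserstein_le hlam hπ).trans_eq ?_
  rw [ProbabilityMeasure.toMeasure_map, integral_map hd.aemeasurable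
    continuous_trimmedCost.measurable.aestronglyMeasurable]
  simp [trimmedCost_self hlam]

theorem robustWasserstein_comm_le (hlam : 0 < lam) (μ ν : ProbabilityMeasure X) :
    robustWasserstein lam μ ν ≤ robustWasserstein lam ν μ := by
  refine le_robustWasserstein fun π hπ => ?_
  have hπ' : π.map measurable_swap.aemeasurable ∈ couplings μ ν := by
    simp only [couplings, Set.mem_ofPred_eq, ProbabilityMeasure.toMeasure_map]
    rw [Measure.map_map (by fun_prop) (by fun_prop), Measure.map_map (by fun_prop) (by fun_prop)]
    exact ⟨hπ.2, hπ.1⟩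
  refine (robustWasserstein_le hlam hπ').trans_eq ?_
  rw [ProbabilityMeasure.toMeasure_map, integral_map (by fun_prop)
    continuous_trimmedCost.measurable.aestronglyMeasurable]
  simp [trimmedCost_comm]

theorem robustWasserstein_comm (hlam : 0 < lam) (μ ν : ProbabilityMeasure X) :
    robustWasserstein lam μ ν = robustWasserstein lam ν μ :=
  (robustWasserstein_comm_le hlam μ ν).antisymm (robustWasserstein_comm_le hlam ν μ)

theorem robustWasserstein_triangle (hlam : 0 < lam) (μ ν κ : ProbabilityMeasure X) :
    robustWasserstein lam μ κ ≤ robustWasserstein lam μ ν + robustWasserstein lam ν κ := by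
  -- Isolating each distance in turn lets arbitrary couplings replace both infima, so no optimal
  -- coupling is needed.
  rw [← sub_le_iff_le_add]
  refine le_robustWasserstein fun π₁ hπ₁ => ?_
  rw [sub_le_comm]
  refine le_robustWasserstein fun π₂ hπ₂ => ?_
  rw [sub_le_iff_le_add']
  obtain ⟨γ, hγ₁, hγ₂⟩ := exists_gluing (π₁ : Measure (X × X)) (π₂ : Measure (X × X))
    (hπ₁.2.trans hπ₂.1.symm)
  have hm₁ : Measurable fun p : X × X × X => (p.2.1, p.1) := by fun_prop
  have hm₂ : Measurable fun p : X × X × X => (p.1, p.2.2) := by fun_prop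
  have : IsProbabilityMeasure (γ.map fun p => (p.1, p.2.2)) := hγ₂ ▸ inferInstance
  have : IsProbabilityMeasure γ :=
    Measure.isProbabilityMeasure_of_map fun p : X × X × X => (p.1, p.2.2)
  let γ' : ProbabilityMeasure (X × X × X) := ⟨γ, this⟩
  have hπ : γ'.map (f := Prod.snd) (by fun_prop) ∈ couplings μ κ := by
    simp only [couplings, Set.mem_ofPred_eq, ProbabilityMeasure.toMeasure_map]
    rw [← hπ₁.1, ← hπ₂.2, ← hγ₁, ← hγ₂]
    simp only [Measure.map_map measurable_fst measurable_snd,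
      Measure.map_map measurable_snd measurable_snd,
      Measure.map_map measurable_fst hm₁, Measure.map_map measurable_snd hm₂]
    exact ⟨rfl, rfl⟩
  refine (robustWasserstein_le hlam hπ).trans ?_
  have hc := (continuous_trimmedCost (X := X) (lam := lam)).measurable
  rw [← hγ₁, ← hγ₂, ProbabilityMeasure.toMeasure_map,
    integral_map (by fun_prop) hc.aestronglyMeasurable,
    integral_map hm₁.aemeasurable hc.aestronglyMeasurable,
    integral_map hm₂.aemeasurable hc.aestronglyMeasurable, ← integral_add
      (integrable_trimmedCost hlam (by fun_prop) (by fun_prop))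
      (integrable_trimmedCost hlam (by fun_prop) (by fun_prop))]
  exact integral_mono (integrable_trimmedCost hlam (by fun_prop) (by fun_prop))
    ((integrable_trimmedCost hlam (by fun_prop) (by fun_prop)).add
      (integrable_trimmedCost hlam (by fun_prop) (by fun_prop)))
    fun p => trimmedCost_triangle hlam _ _ _

/-- A bounded Lipschitz function is Lipschitz with respect to the trimmed cost, so the difference
of its expectations is controlled by the robust Wasserstein distance. -/
theorem abs_integral_sub_le_robustWasserstein (hlam : 0 < lam) {f : X → ℝ} {C : ℝ} {L : ℝ≥0}
    (hC : ∀ x y, dist (f x) (f y) ≤ C) (hL : LipschitzWith L f) (μ ν : ProbabilityMeasure X) :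
    |∫ x, f x ∂(μ : Measure X) - ∫ x, f x ∂(ν : Measure X)| ≤
      max (L : ℝ) (C / (2 * lam)) * robustWasserstein lam μ ν := by
  obtain ⟨x₀⟩ := nonempty_of_isProbabilityMeasure (μ : Measure X)
  have hC₀ : 0 ≤ C := dist_nonneg.trans (hC x₀ x₀)
  -- `L` serves where the cost is the distance, `C / (2 * lam)` where it is cut off.
  set K := max (L : ℝ) (C / (2 * lam)) with hK
  have hK₀ : 0 ≤ K := L.coe_nonneg.trans (le_max_left _ _)
  have hfK : ∀ x y, |f x - f y| ≤ K * trimmedCost lam x y := by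
    intro x y
    rw [trimmedCost, mul_min_of_nonneg _ _ hK₀]
    refine le_min ((hL.dist_le_mul x y).trans ?_) ((hC x y).trans ?_)
    · gcongr; exact le_max_left _ _
    · rw [← div_le_iff₀ (by positivity)]; exact le_max_right _ _
  have hbd : ∀ x, ‖f x‖ ≤ C + ‖f x₀‖ := fun x => by
    have h₁ := hC x x₀
    have h₂ := norm_sub_norm_le (f x) (f x₀)
    rw [dist_eq_norm] at h₁
    linarith
  have hfm : Measurable f := hL.continuous.measurable
  have hint : ∀ (π : ProbabilityMeasure (X × X)) (g : X × X → X), Measurable g →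
      Integrable (fun p => f (g p)) (π : Measure (X × X)) := fun π g hg =>
    Integrable.of_bound (hfm.comp hg).aestronglyMeasurable _ (ae_of_all _ fun p => hbd _)
  rcases hK₀.eq_or_lt with hK₁ | hK₁
  · have hconst : ∀ x, f x = f x₀ := fun x => by
      have := hfK x x₀
      rw [← hK₁, zero_mul] at this
      exact sub_eq_zero.1 (abs_nonpos_iff.1 this)
    simp [hconst, ← hK₁]
  rw [← div_le_iff₀' hK₁]
  refine le_robustWasserstein fun π hπ => ?_
  rw [div_le_iff₀' hK₁, ← hπ.1, ← hπ.2, integral_map (by fun_prop) hfm.aestronglyMeasurable,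
    integral_map (by fun_prop) hfm.aestronglyMeasurable,
    ← integral_sub (hint π _ measurable_fst) (hint π _ measurable_snd), ← integral_const_mul]
  refine abs_integral_le_integral_abs.trans ?_
  exact integral_mono ((hint π _ measurable_fst).sub (hint π _ measurable_snd)).abs
    ((integrable_trimmedCost hlam measurable_fst measurable_snd).const_mul K)
    fun p => hfK p.1 p.2

theorem tendsto_of_tendsto_robustWasserstein (hlam : 0 < lam) {ι : Type*} {l : Filter ι}
    [l.IsCountablyGenerated] {μs : ι → ProbabilityMeasure X} {μ : ProbabilityMeasure X}
    (h : Tendsto (fun i => robustWasserstein lam (μs i) μ) l (𝓝 0)) :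
    Tendsto μs l (𝓝 μ) := by
  rw [tendsto_iff_forall_lipschitz_integral_tendsto]
  rintro f ⟨C, hC⟩ ⟨L, hL⟩
  rw [tendsto_iff_dist_tendsto_zero]
  refine squeeze_zero (fun _ => dist_nonneg)
    (fun i => abs_integral_sub_le_robustWasserstein hlam hC hL (μs i) μ) ?_
  simpa using h.const_mul (max (L : ℝ) (C / (2 * lam)))

/-- The constant sequence `μ` converges weakly to both `μ` and `ν`, and weak limits are unique. -/
theorem eq_of_robustWasserstein_eq_zero (hlam : 0 < lam) {μ ν : ProbabilityMeasure X}
    (h : robustWasserstein lam μ ν = 0) : μ = ν :=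
  tendsto_nhds_unique (f := fun _ : ℕ => μ) (l := atTop) tendsto_const_nhds
    (tendsto_of_tendsto_robustWasserstein hlam (by simp [h]))

end RobustWasserstein

/-! ### Partitions of unity and partial couplings -/

/-- In a separable metric space there is a sequence of nonnegative continuous functions with
supports of small diameter that adds up to `1`, the sum being locally finite at each point. -/
theorem exists_continuous_partition_dist_le {X : Type*} [MetricSpace X]
    [TopologicalSpace.SeparableSpace X] [Nonempty X] {δ : ℝ} (hδ : 0 < δ) :
    ∃ f : ℕ → X → ℝ≥0, (∀ i, Continuous (f i)) ∧
      (∀ i x y, f i x ≠ 0 → f i y ≠ 0 → dist x y ≤ δ) ∧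
      (∀ n x, ∑ i ∈ Finset.range n, f i x ≤ 1) ∧
      ∀ x, ∀ᶠ n in atTop, ∑ i ∈ Finset.range n, f i x = 1 := by
  let u := TopologicalSpace.denseSeq X
  -- A bump equal to `1` within `δ / 4` of `u i` and to `0` beyond `δ / 2`.
  let b : ℕ → X → ℝ≥0 := fun i x => min 1 (Real.toNNReal (2 - dist x (u i) / (δ / 4)))
  -- The increments of the running maximum of the bumps, so that partial sums telescope to that
  -- maximum.
  let f : ℕ → X → ℝ≥0 := fun i x => b i x - (Finset.range i).sup fun j => b j x
  have hb : ∀ i, Continuous (b i) := fun i => by fun_prop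
  have hb₁ : ∀ i x, b i x ≤ 1 := fun i x => min_le_left _ _
  have hsum : ∀ n x, ∑ i ∈ Finset.range n, f i x = (Finset.range n).sup fun i => b i x := by
    intro n x
    induction n with
    | zero => simp
    | succ n ih =>
      rw [Finset.sum_range_succ, ih, add_tsub_eq_max, Finset.range_add_one, Finset.sup_insert,
        sup_comm]
  have hsum₁ : ∀ n x, ∑ i ∈ Finset.range n, f i x ≤ 1 := fun n x => by
    rw [hsum]
    exact Finset.sup_le fun i _ => hb₁ i x
  have hsupp : ∀ i x, f i x ≠ 0 → dist x (u i) ≤ δ / 2 := by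
    intro i x h
    by_contra! hlt
    refine h (tsub_eq_zero_of_le ((min_le_right _ _).trans ?_))
    rw [Real.toNNReal_of_nonpos]
    · exact zero_le
    · rw [sub_nonpos, le_div_iff₀ (by positivity)]
      linarith
  refine ⟨f, fun i => (hb i).sub (by fun_prop), ?_, hsum₁, ?_⟩
  · intro i x y hx hy
    have := dist_triangle_right x y (u i)
    linarith [hsupp i x hx, hsupp i y hy]
  · intro x
    obtain ⟨i, hi⟩ := (TopologicalSpace.denseRange_denseSeq X).exists_dist_lt x
      (show 0 < δ / 4 by positivity)
    filter_upwards [eventually_gt_atTop i] with n hn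
    refine (hsum₁ n x).antisymm ?_
    rw [hsum]
    refine le_trans ?_ (Finset.le_sup (f := fun i => b i x) (Finset.mem_range.2 hn))
    refine le_min le_rfl ?_
    rw [← Real.toNNReal_one]
    refine Real.toNNReal_le_toNNReal ?_
    have : dist x (u i) / (δ / 4) < 1 := (div_lt_one (by positivity)).2 hi
    linarith

/-- A measure on the product whose marginals are dominated by `μ` and `ν` extends to a coupling of
`μ` and `ν`. -/
theorem exists_mem_couplings_add {X Y : Type*} [MeasurableSpace X] [MeasurableSpace Y]
    (μ : ProbabilityMeasure X) (ν : ProbabilityMeasure Y) {ρ : Measure (X × Y)}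
    (h₁ : ρ.map Prod.fst ≤ μ) (h₂ : ρ.map Prod.snd ≤ ν) :
    ∃ π ∈ couplings μ ν, ∃ κ : Measure (X × Y), (π : Measure (X × Y)) = ρ + κ := by
  have hf : IsFiniteMeasure (ρ.map Prod.fst) := isFiniteMeasure_of_le _ h₁
  have hs : IsFiniteMeasure (ρ.map Prod.snd) := isFiniteMeasure_of_le _ h₂
  set α := (μ : Measure X) - ρ.map Prod.fst with hα
  set β := (ν : Measure Y) - ρ.map Prod.snd with hβ
  have hα' : α + ρ.map Prod.fst = μ := Measure.sub_add_cancel_of_le h₁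
  have hβ' : β + ρ.map Prod.snd = ν := Measure.sub_add_cancel_of_le h₂
  have hρf : ρ.map Prod.fst Set.univ = ρ Set.univ := by simp [Measure.map_apply measurable_fst]
  have hρs : ρ.map Prod.snd Set.univ = ρ Set.univ := by simp [Measure.map_apply measurable_snd]
  have hmass : α Set.univ = β Set.univ := by
    rw [hα, hβ, Measure.sub_apply .univ h₁, Measure.sub_apply .univ h₂, hρf, hρs]
    simp
  -- The defects `α` and `β` have equal mass, so their normalized product has them as marginals. If
  -- that mass is zero the scalar is `∞`, but it multiplies the zero measure.
  let κ := (α Set.univ)⁻¹ • α.prod β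
  have hκ₁ : κ.map Prod.fst = α := by
    rw [Measure.map_smul, Measure.map_fst_prod, ← hmass, smul_smul]
    rcases eq_or_ne (α Set.univ) 0 with h | h
    · rw [Measure.measure_univ_eq_zero.1 h, smul_zero]
    · rw [ENNReal.inv_mul_cancel h (measure_ne_top _ _), one_smul]
  have hκ₂ : κ.map Prod.snd = β := by
    rw [Measure.map_smul, Measure.map_snd_prod, hmass, smul_smul]
    rcases eq_or_ne (β Set.univ) 0 with h | h
    · rw [Measure.measure_univ_eq_zero.1 h, smul_zero]
    · rw [ENNReal.inv_mul_cancel h (measure_ne_top _ _), one_smul]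
  have hfst : (ρ + κ).map Prod.fst = μ := by
    rw [Measure.map_add _ _ measurable_fst, hκ₁, add_comm, hα']
  have hsnd : (ρ + κ).map Prod.snd = ν := by
    rw [Measure.map_add _ _ measurable_snd, hκ₂, add_comm, hβ']
  have : IsProbabilityMeasure ((ρ + κ).map Prod.fst) := hfst ▸ inferInstance
  exact ⟨⟨ρ + κ, Measure.isProbabilityMeasure_of_map Prod.fst⟩, ⟨hfst, hsnd⟩, κ, rfl⟩

/-- Two measures restricted by a common finite subpartition of unity can be partially coupled so
that all the mass they share on each piece stays inside that piece. -/
theorem exists_measure_prod_of_subpartition {X : Type*} [MeasurableSpace X] {ι : Type*}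
    (s : Finset ι) {f : ι → X → ℝ≥0} (hf : ∀ i, Measurable (f i)) (hsum : ∀ x, ∑ i ∈ s, f i x ≤ 1)
    (μ ν : Measure X) [IsFiniteMeasure μ] [IsFiniteMeasure ν] :
    ∃ ρ : Measure (X × X), ρ.map Prod.fst ≤ μ ∧ ρ.map Prod.snd ≤ ν ∧
      (∀ᵐ p ∂ρ, ∃ i, f i p.1 ≠ 0 ∧ f i p.2 ≠ 0) ∧
      ρ Set.univ = ∑ i ∈ s, min (∫⁻ x, f i x ∂μ) (∫⁻ x, f i x ∂ν) := by
  have hfm : ∀ i, Measurable fun x => (f i x : ℝ≥0∞) := fun i => (hf i).coe_nnreal_ennreal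
  let r : Measure X → ι → Measure X := fun μ i => μ.withDensity fun x => (f i x : ℝ≥0∞)
  have hr : ∀ μ i, r μ i Set.univ = ∫⁻ x, f i x ∂μ := fun μ i => by simp [r]
  have hle : ∀ μ : Measure X, ∑ i ∈ s, r μ i ≤ μ := by
    intro μ
    rw [Measure.le_iff]
    intro t ht
    simp only [Measure.coe_finsetSum, Finset.sum_apply, r, withDensity_apply _ ht]
    rw [← lintegral_finsetSum _ fun i _ => hfm i]
    refine (lintegral_mono (g := fun _ => 1) fun x => ?_).trans_eq (by simp)
    rw [← ENNReal.ofNNReal_finsetSum]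
    exact ENNReal.coe_le_one_iff.2 (hsum x)
  have hfin : ∀ (μ : Measure X) [IsFiniteMeasure μ], ∀ i ∈ s, IsFiniteMeasure (r μ i) := by
    intro μ _ i hi
    refine isFiniteMeasure_of_le μ (le_trans ?_ (hle μ))
    exact Finset.single_le_sum (f := r μ) (fun _ _ => Measure.zero_le _) hi
  -- Dividing the product by the larger mass leaves total mass equal to the smaller one and scales
  -- each marginal by a factor at most `1`.
  let c : ι → ℝ≥0∞ := fun i => (max (r μ i Set.univ) (r ν i Set.univ))⁻¹
  have hmem : ∀ i ∈ s, r μ i Set.univ ≠ ∞ ∧ r ν i Set.univ ≠ ∞ := fun i hi =>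
    ⟨(hfin μ i hi).measure_univ_lt_top.ne, (hfin ν i hi).measure_univ_lt_top.ne⟩
  have hc₁ : ∀ i, c i * r ν i Set.univ ≤ 1 := fun i =>
    (mul_le_mul_right (le_max_right _ _) _).trans (ENNReal.inv_mul_le_one _)
  have hc₂ : ∀ i, c i * r μ i Set.univ ≤ 1 := fun i =>
    (mul_le_mul_right (le_max_left _ _) _).trans (ENNReal.inv_mul_le_one _)
  have hsmul : ∀ (a : ℝ≥0∞) (m : Measure X), a ≤ 1 → a • m ≤ m := fun a m ha t => by
    simpa using mul_le_of_le_one_left' ha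
  refine ⟨∑ i ∈ s, c i • (r μ i).prod (r ν i), ?_, ?_, ?_, ?_⟩
  · refine le_trans ?_ (hle μ)
    rw [Measure.map_finset_sum measurable_fst.aemeasurable]
    refine Finset.sum_le_sum fun i _ => ?_
    rw [Measure.map_smul, Measure.map_fst_prod, smul_smul]
    exact hsmul _ _ (hc₁ i)
  · refine le_trans ?_ (hle ν)
    rw [Measure.map_finset_sum measurable_snd.aemeasurable]
    refine Finset.sum_le_sum fun i _ => ?_
    rw [Measure.map_smul, Measure.map_snd_prod, smul_smul]
    exact hsmul _ _ (hc₂ i)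
  · rw [ae_finsetSum_measure_iff]
    refine fun i _ => Measure.ae_smul_measure ?_ _
    have h : ∀ μ : Measure X, ∀ᵐ x ∂r μ i, f i x ≠ 0 := fun μ => by
      rw [ae_withDensity_iff (hfm i)]
      exact ae_of_all _ fun x hx => by exact_mod_cast hx
    filter_upwards [Measure.quasiMeasurePreserving_fst.ae (h μ),
      Measure.quasiMeasurePreserving_snd.ae (h ν)] with p hp₁ hp₂ using ⟨i, hp₁, hp₂⟩
  · simp only [Measure.coe_finsetSum, Finset.sum_apply, Measure.smul_apply, smul_eq_mul]
    refine Finset.sum_congr rfl fun i hi => ?_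
    rw [← Set.univ_prod_univ, Measure.prod_prod, ← hr, ← hr,
      ← max_mul_min (r μ i Set.univ), ← mul_assoc]
    rcases eq_or_ne (max (r μ i Set.univ) (r ν i Set.univ)) 0 with h | h
    · have : min (r μ i Set.univ) (r ν i Set.univ) = 0 :=
        le_antisymm (min_le_max.trans h.le) zero_le
      rw [this, mul_zero]
    · rw [ENNReal.inv_mul_cancel h (max_lt (hmem i hi).1.lt_top (hmem i hi).2.lt_top).ne, one_mul]

/-! ### Weak convergence implies convergence in distance -/

section RobustWasserstein

variable {X : Type*} [MetricSpace X] [PolishSpace X] [MeasurableSpace X] [BorelSpace X] {lam : ℝ}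

/-- A partial coupling along which points are moved by at most `δ` bounds the robust Wasserstein
distance. -/
theorem robustWasserstein_le_of_partial_coupling (hlam : 0 < lam) {μ ν : ProbabilityMeasure X}
    {ρ : Measure (X × X)} (h₁ : ρ.map Prod.fst ≤ μ) (h₂ : ρ.map Prod.snd ≤ ν)
    {δ : ℝ} (hδ : 0 ≤ δ) (hρ : ∀ᵐ p ∂ρ, dist p.1 p.2 ≤ δ) :
    robustWasserstein lam μ ν ≤ δ + 2 * lam * (1 - ρ.real Set.univ) := by
  obtain ⟨π, hπ, κ, hκ⟩ := exists_mem_couplings_add μ ν h₁ h₂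
  have hρ' : IsFiniteMeasure ρ := isFiniteMeasure_of_le (π : Measure (X × X)) (hκ ▸ Measure.le_add_right le_rfl)
  have hκ' : IsFiniteMeasure κ := isFiniteMeasure_of_le (π : Measure (X × X)) (hκ ▸ Measure.le_add_left le_rfl)
  have hint : ∀ m : Measure (X × X), IsFiniteMeasure m →
      Integrable (fun p => trimmedCost lam p.1 p.2) m := fun m _ =>
    integrable_trimmedCost hlam measurable_fst measurable_snd
  have hmass : ρ.real Set.univ + κ.real Set.univ = 1 := by
    rw [← measureReal_add_apply, ← hκ]; simp
  have hIρ : ∫ p, trimmedCost lam p.1 p.2 ∂ρ ≤ ρ.real Set.univ * δ := by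
    refine (integral_mono_ae (hint ρ hρ') (integrable_const δ) ?_).trans_eq (by simp)
    filter_upwards [hρ] with p hp using (min_le_left _ _).trans hp
  have hIκ : ∫ p, trimmedCost lam p.1 p.2 ∂κ ≤ κ.real Set.univ * (2 * lam) :=
    (integral_mono (hint κ hκ') (integrable_const (2 * lam)) fun p =>
      trimmedCost_le _ _).trans_eq (by simp)
  have hκ₀ : 0 ≤ κ.real Set.univ := measureReal_nonneg
  refine (robustWasserstein_le hlam hπ).trans ?_
  rw [hκ, integral_add_measure (hint ρ hρ') (hint κ hκ'), ← hmass]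
  nlinarith

theorem tendsto_lintegral_of_continuous_of_le_one {X : Type*} [TopologicalSpace X]
    [MeasurableSpace X] [OpensMeasurableSpace X] {ι : Type*} {l : Filter ι}
    {μs : ι → ProbabilityMeasure X} {μ : ProbabilityMeasure X} (h : Tendsto μs l (𝓝 μ))
    {f : X → ℝ≥0} (hf : Continuous f) (hf₁ : ∀ x, f x ≤ 1) :
    Tendsto (fun i => ∫⁻ x, f x ∂(μs i : Measure X)) l (𝓝 (∫⁻ x, f x ∂(μ : Measure X))) := by
  refine ProbabilityMeasure.tendsto_iff_forall_lintegral_tendsto.1 h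
    (BoundedContinuousFunction.mkOfBound ⟨f, hf⟩ 1 fun x y => ?_)
  have hx : (f x : ℝ) ≤ 1 := by exact_mod_cast hf₁ x
  have hy : (f y : ℝ) ≤ 1 := by exact_mod_cast hf₁ y
  rw [NNReal.dist_eq, abs_sub_le_iff]
  simp only [ContinuousMap.coe_mk]
  constructor <;> linarith [(f x).coe_nonneg, (f y).coe_nonneg]

/-- The number `n` of pieces is chosen from `μ` alone, before `k`; only finitely many integrals then
have to converge. The filter is arbitrary, so that neighbourhood filters are covered. -/
theorem tendsto_robustWasserstein_of_tendsto (hlam : 0 < lam) {ι : Type*} {l : Filter ι}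
    {μs : ι → ProbabilityMeasure X} {μ : ProbabilityMeasure X} (h : Tendsto μs l (𝓝 μ)) :
    Tendsto (fun i => robustWasserstein lam (μs i) μ) l (𝓝 0) := by
  have : Nonempty X := nonempty_of_isProbabilityMeasure (μ : Measure X)
  suffices H : ∀ δ : ℝ, 0 < δ → ∀ᶠ i in l, robustWasserstein lam (μs i) μ ≤ δ + 2 * lam * δ by
    rw [Metric.tendsto_nhds]
    intro ε hε
    filter_upwards [H (ε / (2 * (1 + 2 * lam))) (by positivity)] with i hi
    rw [Real.dist_eq, sub_zero, abs_of_nonneg (robustWasserstein_nonneg hlam _ _)]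
    refine hi.trans_lt ?_
    have : ε / (2 * (1 + 2 * lam)) + 2 * lam * (ε / (2 * (1 + 2 * lam))) = ε / 2 := by field_simp
    linarith
  intro δ hδ
  obtain ⟨f, hfc, hfd, hfs, hf1⟩ := exists_continuous_partition_dist_le (X := X) hδ
  have hfm : ∀ i, Measurable fun x => (f i x : ℝ≥0∞) := fun i =>
    (hfc i).measurable.coe_nnreal_ennreal
  have hlim : Tendsto (fun n => ∑ i ∈ Finset.range n, ∫⁻ x, f i x ∂(μ : Measure X)) atTop
      (𝓝 1) := by
    have key : Tendsto (fun n => ∫⁻ x, ∑ i ∈ Finset.range n, (f i x : ℝ≥0∞) ∂(μ : Measure X))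
        atTop (𝓝 (∫⁻ _, 1 ∂(μ : Measure X))) := by
      refine lintegral_tendsto_of_tendsto_of_monotone
        (fun n => (Finset.measurable_sum _ fun i _ => hfm i).aemeasurable)
        (ae_of_all _ fun x m n hmn => ?_) (ae_of_all _ fun x => ?_)
      · exact Finset.sum_le_sum_of_subset (Finset.range_mono hmn)
      · refine tendsto_const_nhds.congr' ?_
        filter_upwards [hf1 x] with n hn
        exact_mod_cast hn.symm
    simpa [lintegral_finsetSum _ fun i _ => hfm i] using key
  have hlt : 1 - ENNReal.ofReal δ < 1 :=
    ENNReal.sub_lt_self ENNReal.one_ne_top one_ne_zero (by simpa using hδ)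
  obtain ⟨n, hn⟩ := (hlim.eventually (lt_mem_nhds hlt)).exists
  have hf_le : ∀ i x, f i x ≤ 1 := fun i x =>
    (Finset.single_le_sum (f := fun j => f j x) (fun _ _ => zero_le)
      (Finset.self_mem_range_succ i)).trans (hfs (i + 1) x)
  have hmin : Tendsto (fun k => ∑ i ∈ Finset.range n,
      min (∫⁻ x, f i x ∂(μs k : Measure X)) (∫⁻ x, f i x ∂(μ : Measure X))) l
      (𝓝 (∑ i ∈ Finset.range n, ∫⁻ x, f i x ∂(μ : Measure X))) := by
    refine tendsto_finsetSum _ fun i _ => ?_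
    simpa using (tendsto_lintegral_of_continuous_of_le_one h (hfc i) (hf_le i)).min
      (tendsto_const_nhds (x := ∫⁻ x, f i x ∂(μ : Measure X)))
  filter_upwards [hmin.eventually (lt_mem_nhds hn)] with k hk
  obtain ⟨ρ, hρ₁, hρ₂, hρd, hρm⟩ := exists_measure_prod_of_subpartition (Finset.range n)
    (fun i => (hfc i).measurable) (hfs n) (μs k : Measure X) (μ : Measure X)
  refine (robustWasserstein_le_of_partial_coupling hlam hρ₁ hρ₂ hδ.le ?_).trans ?_
  · filter_upwards [hρd] with p hp
    obtain ⟨i, hi₁, hi₂⟩ := hp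
    exact hfd i _ _ hi₁ hi₂
  · rw [← hρm] at hk
    have hρu : ρ Set.univ ≤ 1 := by
      have := hρ₁ Set.univ
      rwa [Measure.map_apply measurable_fst .univ, Set.preimage_univ,
        measure_univ (μ := (μs k : Measure X))] at this
    have hρt : ρ Set.univ ≠ ∞ := (hρu.trans_lt ENNReal.one_lt_top).ne
    have : 1 - δ ≤ ρ.real Set.univ := by
      have h₁ : 1 ≤ ρ Set.univ + ENNReal.ofReal δ := tsub_le_iff_right.1 hk.le
      have h₂ := ENNReal.toReal_mono (by finiteness) h₁
      rw [ENNReal.toReal_add (by finiteness) (by finiteness), ENNReal.toReal_ofReal hδ.le,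
        ENNReal.toReal_one] at h₂
      rw [measureReal_def]
      linarith
    gcongr
    linarith

theorem tendsto_iff_tendsto_robustWasserstein (hlam : 0 < lam) {ι : Type*} {l : Filter ι}
    [l.IsCountablyGenerated] {μs : ι → ProbabilityMeasure X} {μ : ProbabilityMeasure X} :
    Tendsto μs l (𝓝 μ) ↔ Tendsto (fun i => robustWasserstein lam (μs i) μ) l (𝓝 0) :=
  ⟨tendsto_robustWasserstein_of_tendsto hlam, tendsto_of_tendsto_robustWasserstein hlam⟩

theorem metrizes_robustWasserstein (hlam : 0 < lam) :
    Metrizes fun μ ν : ProbabilityMeasure X => robustWasserstein lam μ ν := by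
  let M : MetricSpace (ProbabilityMeasure X) :=
    { dist := robustWasserstein lam
      dist_self := robustWasserstein_self hlam
      dist_comm := robustWasserstein_comm hlam
      dist_triangle := robustWasserstein_triangle hlam
      eq_of_dist_eq_zero := eq_of_robustWasserstein_eq_zero hlam }
  refine ⟨M, fun _ _ => rfl, TopologicalSpace.ext_nhds fun μ => ?_⟩
  have hM : @nhds _ M.toUniformSpace.toTopologicalSpace μ =
      comap (fun ν => robustWasserstein lam ν μ) (𝓝 0) :=
    (@nhds_comap_dist _ M.toPseudoMetricSpace μ).symm
  rw [hM]
  -- The two directions are applied to the identity map, along the filter of distance balls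
  -- (countably generated, as a comap from the reals) and along the weak neighbourhood filter.
  apply le_antisymm
  · exact (tendsto_iff_tendsto_robustWasserstein hlam).2 tendsto_comap
  · exact tendsto_iff_comap.1 ((tendsto_iff_tendsto_robustWasserstein hlam).1 tendsto_id)

theorem tendsto_robustWasserstein (hlam : 0 < lam) {ι : Type*} {l : Filter ι}
    {μs νs : ι → ProbabilityMeasure X} {μ ν : ProbabilityMeasure X}
    (hμ : Tendsto μs l (𝓝 μ)) (hν : Tendsto νs l (𝓝 ν)) :
    Tendsto (fun i => robustWasserstein lam (μs i) (νs i)) l (𝓝 (robustWasserstein lam μ ν)) := by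
  obtain ⟨M, hd, ht⟩ := metrizes_robustWasserstein (X := X) hlam
  rw [← ht] at hμ hν
  simpa only [← hd] using hμ.dist hν

end RobustWasserstein

theorem theorem4 {X : Type*} [MetricSpace X] [PolishSpace X] [MeasurableSpace X] [BorelSpace X]
    (lam : ℝ) (hlam : 0 < lam) :
    Metrizes (fun μ ν : ProbabilityMeasure X => robustWasserstein lam μ ν) ∧
    (∀ (μs : ℕ → ProbabilityMeasure X) (μ : ProbabilityMeasure X),
      Tendsto μs atTop (𝓝 μ) ↔
        Tendsto (fun k => robustWasserstein lam (μs k) μ) atTop (𝓝 0)) ∧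
    (∀ (μs νs : ℕ → ProbabilityMeasure X) (μ ν : ProbabilityMeasure X),
      Tendsto μs atTop (𝓝 μ) → Tendsto νs atTop (𝓝 ν) →
        Tendsto (fun k => robustWasserstein lam (μs k) (νs k)) atTop
          (𝓝 (robustWasserstein lam μ ν))) :=
  ⟨metrizes_robustWasserstein hlam, fun _ _ => tendsto_iff_tendsto_robustWasserstein hlam,
    fun _ _ _ _ => tendsto_robustWasserstein hlam⟩
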